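/- **Syntax.** Fix a set of datatype constructors $c$ and a countably infinite set of nominals. The abstract syntax of core MLTS has terms (identified up to $\alpha$-conversion) $$M ::= x \mid a \mid \mathrm{lam}(\lambda x.M) \mid \mathrm{app}\,M\,N \mid \mathrm{let}\,M\,(\lambda x.N)\mid \mathrm{fix}(\lambda x.M)\mid \mathrm{new}(\lambda X.M)\mid \mathrm{back}(\lambda X.M)\mid M\,@\,N\mid \mathrm{variant}\,c\,[M_1,\dots,M_n]\mid \mathrm{match}\,M\,[R_1,\dots,R_n]$$ with $a$ a nominal, patterns $$p ::= \mathrm{pvar}\,x\mid \mathrm{pnom}\,X\mid \mathrm{pvariant}\,c\,[p_1,\dots,p_n]\mid \mathrm{pback}(\lambda X.p)\mid p\,@\,X$$ and match rules $R = \mathrm{all}\,x_1\dots\mathrm{all}\,x_k.\ \mathrm{nab}\,Z_1\dots\mathrm{nab}\,Z_m.\,(p\Longrightarrow u)$; the $x_i$ are the pattern variables of $R$. (When a term is substituted for a variable below $\mathrm{pvar}$ or $\mathrm{pnom}$, the result is an instance such as $\mathrm{pvar}\,t$.) **Evaluation** $E\Downarrow V$ on terms without free variables (they may contain nominals) is inductively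 defined by: * $a\Downarrow a$ for a nominal $a$; $\mathrm{lam}\,R\Downarrow\mathrm{lam}\,R$; $\mathrm{variant}\,c\,[T_i]_i\Downarrow\mathrm{variant}\,c\,[V_i]_i$ if $T_i\Downarrow V_i$ for all $i$; * $\mathrm{app}\,M\,N\Downarrow V$ if $M\Downarrow\mathrm{lam}\,R$, $N\Downarrow U$ and $R\,U\Downarrow V$; $\mathrm{let}\,M\,R\Downarrow V$ if $M\Downarrow U$ and $R\,U\Downarrow V$; $\mathrm{fix}\,R\Downarrow V$ if $R\,(\mathrm{fix}\,R)\Downarrow V$; $M\,@\,N\Downarrow V$ if $M\Downarrow\mathrm{back}\,R$ and $R\,N\Downarrow V$; * for a nominal $a$ occurring neither in $E$ nor in $V$: $\mathrm{new}\,E\Downarrow V$ if $E\,a\Downarrow V$, and $\mathrm{back}\,E\Downarrow\mathrm{back}\,V$ if $E\,a\Downarrow V\,a$; * $\mathrm{match}\,T\,(R::Rs)\Downarrow V$ if either matching $T$ against $R$ yields some $U$ with $U\Downarrow V$, or matching $T$ against $R$ yields nothing and $\mathrm{match}\,T\,Rs\Downarrow V$. Here matching $T$ against $\mathrm{all}\,(\lambda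 x.R)$ yields $U$ if for some term $t$ matching $T$ against $R[t/x]$ yields $U$; matching $T$ against $\mathrm{nab}\,Z_1\dots\mathrm{nab}\,Z_m.(p\Longrightarrow u)$ yields $U$ if there are a pattern $P$ and distinct nominals $c_1,\dots,c_m$ such that $T$ matches $P$ and $\lambda Z_1\dots\lambda Z_m.(p\Longrightarrow u)=\lambda c_1\dots\lambda c_m.(P\Longrightarrow U)$. The relation "$T$ matches $P$" is inductively defined by: $t$ matches $\mathrm{pvar}\,t$; a nominal $a$ matches $\mathrm{pnom}\,a$; $\mathrm{variant}\,c\,[t_i]_i$ matches $\mathrm{pvariant}\,c\,[p_i]_i$ if each $t_i$ matches $p_i$; $\mathrm{back}\,t$ matches $\mathrm{pback}\,p$ if $t\,a$ matches $p\,a$ for a nominal $a$ not occurring in $t,p$; $R\,a$ matches $p\,@\,a$ ($a$ a nominal) if $\mathrm{back}\,R$ matches $p$. **Matching restrictions.** Every match rule occurring in the program satisfies: (1) each pattern variable of the rule occurs exactly once in its pattern, and $\mathrm{pvar}$ is applied only to pattern variables of the rule, $\mathrm{pnom}$ never to one; (2) $@$ occurs in the pattern only in the form $r\,@\,X_1\cdots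 X_n$ where $r$ is a pattern variable of the rule and $X_1,\dots,X_n$ are distinct nominals bound within the scope of $r$, i.e. bound by the $\mathrm{nab}$s of the rule or by an enclosing backslash of the pattern; (3) each $\mathrm{nab}$-bound nominal has at least one rigid occurrence in the pattern, i.e. an occurrence that is not in the scope of an $@$. **Theorem (Determinacy of evaluation).** Let $E$ be a term without free variables that satisfies the matching restrictions. If $E\Downarrow V$ and $E\Downarrow U$, then $V=U$ (up to $\alpha$-conversion). -/

import Mathlib

/-!
Abstract syntax and natural semantics of the core of MLTS.

Object-level binders are represented by well-scoped de Bruijn *levels*: an element of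
`Syn C n k` is a phrase of sort `k` whose free variables are among `0, …, n-1`, and a binder
occurring in scope `n` binds the variable `n`.  Hence Lean equality of phrases is equality of
the corresponding simply typed lambda-terms modulo conversion.  Nominal constants are the
natural numbers, `C` is the set of datatype constructors.
-/

namespace MLTS

/-- The syntactic sorts: terms, patterns, branches `p ⟹ u`, match rules, lists of rules. -/
inductive Kind where
  | tm | pat | branch | rule | rules

/-- Abstract syntax.  A match rule has the form
`all x₁ … all xₖ. nab Z₁ … nab Zₘ. (p ⟹ u)`; its `nab` prefix is taken in one block. -/
inductive Syn (C : Type*) : ℕ → Kind → Type _ where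
  -- terms
  | nom {n : ℕ} (a : ℕ) : Syn C n .tm
  | var {n : ℕ} (i : Fin n) : Syn C n .tm
  | lam {n : ℕ} (R : Syn C (n + 1) .tm) : Syn C n .tm
  | app {n : ℕ} (M N : Syn C n .tm) : Syn C n .tm
  | letin {n : ℕ} (M : Syn C n .tm) (R : Syn C (n + 1) .tm) : Syn C n .tm
  | fix {n : ℕ} (R : Syn C (n + 1) .tm) : Syn C n .tm
  | new {n : ℕ} (E : Syn C (n + 1) .tm) : Syn C n .tm
  | back {n : ℕ} (E : Syn C (n + 1) .tm) : Syn C n .tm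
  | arob {n : ℕ} (M N : Syn C n .tm) : Syn C n .tm
  | variant {n : ℕ} (c : C) (k : ℕ) (ts : Fin k → Syn C n .tm) : Syn C n .tm
  | mtch {n : ℕ} (T : Syn C n .tm) (rs : Syn C n .rules) : Syn C n .tm
  -- patterns
  | pvar {n : ℕ} (e : Syn C n .tm) : Syn C n .pat
  | pnom {n : ℕ} (e : Syn C n .tm) : Syn C n .pat
  | pvariant {n : ℕ} (c : C) (k : ℕ) (ps : Fin k → Syn C n .pat) : Syn C n .pat
  | pback {n : ℕ} (p : Syn C (n + 1) .pat) : Syn C n .pat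
  | parob {n : ℕ} (p : Syn C n .pat) (e : Syn C n .tm) : Syn C n .pat
  -- branches, rules and lists of rules
  | branch {n : ℕ} (p : Syn C n .pat) (u : Syn C n .tm) : Syn C n .branch
  | nab {n : ℕ} (m : ℕ) (b : Syn C (n + m) .branch) : Syn C n .rule
  | all {n : ℕ} (r : Syn C (n + 1) .rule) : Syn C n .rule
  | nil {n : ℕ} : Syn C n .rules
  | cons {n : ℕ} (r : Syn C n .rule) (rs : Syn C n .rules) : Syn C n .rules

/-- Terms with `n` free variables; `Tm C 0` is the type of closed terms, which may
contain nominals. -/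
abbrev Tm (C : Type*) (n : ℕ) := Syn C n .tm

/-- Patterns with `n` free variables. -/
abbrev Pat (C : Type*) (n : ℕ) := Syn C n .pat

/-- Extend a renaming under `k` binders. -/
def liftRen {n m : ℕ} (k : ℕ) (ξ : Fin n → Fin m) : Fin (n + k) → Fin (m + k) :=
  Fin.append (fun i => Fin.castAdd k (ξ i)) (Fin.natAdd m)

namespace Syn

/-- Renaming of variables. -/
def ren {C : Type*} : {n m : ℕ} → {k : Kind} → (Fin n → Fin m) → Syn C n k → Syn C m k
  | _, _, _, _, nom a => nom a
  | _, _, _, ξ, var i => var (ξ i)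
  | _, _, _, ξ, lam R => lam (R.ren (liftRen 1 ξ))
  | _, _, _, ξ, app M N => app (M.ren ξ) (N.ren ξ)
  | _, _, _, ξ, letin M R => letin (M.ren ξ) (R.ren (liftRen 1 ξ))
  | _, _, _, ξ, fix R => fix (R.ren (liftRen 1 ξ))
  | _, _, _, ξ, new E => new (E.ren (liftRen 1 ξ))
  | _, _, _, ξ, back E => back (E.ren (liftRen 1 ξ))
  | _, _, _, ξ, arob M N => arob (M.ren ξ) (N.ren ξ)
  | _, _, _, ξ, variant c k ts => variant c k (fun i => (ts i).ren ξ)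
  | _, _, _, ξ, mtch T rs => mtch (T.ren ξ) (rs.ren ξ)
  | _, _, _, ξ, pvar e => pvar (e.ren ξ)
  | _, _, _, ξ, pnom e => pnom (e.ren ξ)
  | _, _, _, ξ, pvariant c k ps => pvariant c k (fun i => (ps i).ren ξ)
  | _, _, _, ξ, pback p => pback (p.ren (liftRen 1 ξ))
  | _, _, _, ξ, parob p e => parob (p.ren ξ) (e.ren ξ)
  | _, _, _, ξ, branch p u => branch (p.ren ξ) (u.ren ξ)
  | _, _, _, ξ, nab l b => nab l (b.ren (liftRen l ξ))
  | _, _, _, ξ, all r => all (r.ren (liftRen 1 ξ))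
  | _, _, _, _, nil => nil
  | _, _, _, ξ, cons r rs => cons (r.ren ξ) (rs.ren ξ)

/-- Weakening by `k` variables. -/
def weak {C : Type*} {n : ℕ} {s : Kind} (k : ℕ) (t : Syn C n s) : Syn C (n + k) s :=
  t.ren (Fin.castAdd k)

/-- Extend a substitution for variables under `k` binders. -/
def lift {C : Type*} {n m : ℕ} (k : ℕ) (σ : Fin n → Tm C m) : Fin (n + k) → Tm C (m + k) :=
  Fin.append (fun i => (σ i).weak k) (fun j => var (Fin.natAdd m j))

/-- Extend a substitution for nominals under `k` binders. -/
def liftNom {C : Type*} {m : ℕ} (k : ℕ) (ν : ℕ → Tm C m) : ℕ → Tm C (m + k) :=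
  fun a => (ν a).weak k

/-- Simultaneous capture-avoiding substitution of `σ` for variables and `ν` for nominals. -/
def sub {C : Type*} : {n m : ℕ} → {k : Kind} → (Fin n → Tm C m) → (ℕ → Tm C m) →
    Syn C n k → Syn C m k
  | _, _, _, _, ν, nom a => ν a
  | _, _, _, σ, _, var i => σ i
  | _, _, _, σ, ν, lam R => lam (R.sub (lift 1 σ) (liftNom 1 ν))
  | _, _, _, σ, ν, app M N => app (M.sub σ ν) (N.sub σ ν)
  | _, _, _, σ, ν, letin M R => letin (M.sub σ ν) (R.sub (lift 1 σ) (liftNom 1 ν))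
  | _, _, _, σ, ν, fix R => fix (R.sub (lift 1 σ) (liftNom 1 ν))
  | _, _, _, σ, ν, new E => new (E.sub (lift 1 σ) (liftNom 1 ν))
  | _, _, _, σ, ν, back E => back (E.sub (lift 1 σ) (liftNom 1 ν))
  | _, _, _, σ, ν, arob M N => arob (M.sub σ ν) (N.sub σ ν)
  | _, _, _, σ, ν, variant c k ts => variant c k (fun i => (ts i).sub σ ν)
  | _, _, _, σ, ν, mtch T rs => mtch (T.sub σ ν) (rs.sub σ ν)
  | _, _, _, σ, ν, pvar e => pvar (e.sub σ ν)
  | _, _, _, σ, ν, pnom e => pnom (e.sub σ ν)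
  | _, _, _, σ, ν, pvariant c k ps => pvariant c k (fun i => (ps i).sub σ ν)
  | _, _, _, σ, ν, pback p => pback (p.sub (lift 1 σ) (liftNom 1 ν))
  | _, _, _, σ, ν, parob p e => parob (p.sub σ ν) (e.sub σ ν)
  | _, _, _, σ, ν, branch p u => branch (p.sub σ ν) (u.sub σ ν)
  | _, _, _, σ, ν, nab l b => nab l (b.sub (lift l σ) (liftNom l ν))
  | _, _, _, σ, ν, all r => all (r.sub (lift 1 σ) (liftNom 1 ν))
  | _, _, _, _, _, nil => nil
  | _, _, _, σ, ν, cons r rs => cons (r.sub σ ν) (rs.sub σ ν)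

/-- The application `(R s)` of an abstraction `R` to a term `s`: substitute `s` for the last
variable. -/
def inst {C : Type*} {n : ℕ} {k : Kind} (R : Syn C (n + 1) k) (s : Tm C n) : Syn C n k :=
  R.sub (Fin.append var (fun _ : Fin 1 => s)) nom

open Classical in
/-- The body of the abstraction `λ c₁ … λ cₘ. t` of the nominals `c₁, …, cₘ` over `t`: each
`cᵢ` is replaced by the `i`-th of `m` new variables. -/
noncomputable def abstr {C : Type*} {n m : ℕ} {k : Kind} (c : Fin m → ℕ) (t : Syn C n k) :
    Syn C (n + m) k :=
  t.sub (fun i => var (Fin.castAdd m i))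
    (fun a => if h : ∃ i, c i = a then var (Fin.natAdd n h.choose) else nom a)

/-- The nominal `a` occurs in the phrase. -/
def Occurs {C : Type*} (a : ℕ) : {n : ℕ} → {k : Kind} → Syn C n k → Prop
  | _, _, nom b => a = b
  | _, _, var _ => False
  | _, _, lam R => R.Occurs a
  | _, _, app M N => M.Occurs a ∨ N.Occurs a
  | _, _, letin M R => M.Occurs a ∨ R.Occurs a
  | _, _, fix R => R.Occurs a
  | _, _, new E => E.Occurs a
  | _, _, back E => E.Occurs a
  | _, _, arob M N => M.Occurs a ∨ N.Occurs a
  | _, _, variant _ _ ts => ∃ i, (ts i).Occurs a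
  | _, _, mtch T rs => T.Occurs a ∨ rs.Occurs a
  | _, _, pvar e => e.Occurs a
  | _, _, pnom e => e.Occurs a
  | _, _, pvariant _ _ ps => ∃ i, (ps i).Occurs a
  | _, _, pback p => p.Occurs a
  | _, _, parob p e => p.Occurs a ∨ e.Occurs a
  | _, _, branch p u => p.Occurs a ∨ u.Occurs a
  | _, _, nab _ b => b.Occurs a
  | _, _, all r => r.Occurs a
  | _, _, nil => False
  | _, _, cons r rs => r.Occurs a ∨ rs.Occurs a

end Syn

open Syn

/-- Nominal abstraction `s ⊵ t` of degree `m`: the `m`-ary abstraction with body `s` equals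
`λ c₁ … λ cₘ. t` for some distinct nominals `c₁, …, cₘ`. -/
def NomAbs {C : Type*} {n m : ℕ} {k : Kind} (s : Syn C (n + m) k) (t : Syn C n k) : Prop :=
  ∃ c : Fin m → ℕ, Function.Injective c ∧ s = t.abstr c

/-! ### Natural semantics

A premise `∇ X. B X` is rendered as `B a` for a nominal `a` not occurring in `B`. -/

/-- `Matches T P`: the term `T` is matched by the (instantiated) pattern `P`. -/
inductive Matches {C : Type*} : Tm C 0 → Pat C 0 → Prop where
  | variant (c : C) (k : ℕ) (ts : Fin k → Tm C 0) (ps : Fin k → Pat C 0) :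
      (∀ i, Matches (ts i) (ps i)) → Matches (variant c k ts) (pvariant c k ps)
  | nom (a : ℕ) : Matches (nom a) (pnom (nom a))
  | var (t : Tm C 0) : Matches t (pvar t)
  | back (t : Tm C 1) (p : Pat C 1) (a : ℕ) : ¬ t.Occurs a → ¬ p.Occurs a →
      Matches (t.inst (nom a)) (p.inst (nom a)) → Matches (back t) (pback p)
  | arob (s : Tm C 0) (R : Tm C 1) (p : Pat C 0) (a : ℕ) : s = R.inst (nom a) →
      Matches (back R) p → Matches s (parob p (nom a))

/-- `Clause T r U`: matching the term `T` against the rule `r` yields the right-hand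
side `U`. -/
inductive Clause {C : Type*} (T : Tm C 0) : Syn C 0 .rule → Tm C 0 → Prop where
  | all (r : Syn C 1 .rule) (x U : Tm C 0) : Clause T (r.inst x) U → Clause T (all r) U
  | nab (m : ℕ) (b : Syn C (0 + m) .branch) (P : Pat C 0) (U : Tm C 0) :
      Matches T P → NomAbs b (branch P U) → Clause T (nab m b) U

/-- `Eval E V`: the evaluation judgment `E ⇓ V`. -/
inductive Eval {C : Type*} : Tm C 0 → Tm C 0 → Prop where
  | nom (a : ℕ) : Eval (nom a) (nom a)
  | lam (R : Tm C 1) : Eval (lam R) (lam R)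
  | variant (c : C) (k : ℕ) (ts vs : Fin k → Tm C 0) :
      (∀ i, Eval (ts i) (vs i)) → Eval (variant c k ts) (variant c k vs)
  | new (E : Tm C 1) (V : Tm C 0) (a : ℕ) : ¬ E.Occurs a → ¬ V.Occurs a →
      Eval (E.inst (nom a)) V → Eval (new E) V
  | app (M N U V : Tm C 0) (R : Tm C 1) :
      Eval M (lam R) → Eval N U → Eval (R.inst U) V → Eval (app M N) V
  | letin (M U V : Tm C 0) (R : Tm C 1) :
      Eval M U → Eval (R.inst U) V → Eval (letin M R) V
  | fix (R : Tm C 1) (V : Tm C 0) : Eval (R.inst (fix R)) V → Eval (fix R) V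
  | arob (M X V : Tm C 0) (R : Tm C 1) :
      Eval M (back R) → Eval (R.inst X) V → Eval (arob M X) V
  | back (E V : Tm C 1) (a : ℕ) : ¬ E.Occurs a → ¬ V.Occurs a →
      Eval (E.inst (nom a)) (V.inst (nom a)) → Eval (back E) (back V)
  | matchHead (T U V : Tm C 0) (r : Syn C 0 .rule) (rs : Syn C 0 .rules) :
      Clause T r U → Eval U V → Eval (mtch T (cons r rs)) V
  | matchTail (T V : Tm C 0) (r : Syn C 0 .rule) (rs : Syn C 0 .rules) :
      (¬ ∃ u, Clause T r u) → Eval (mtch T rs) V → Eval (mtch T (cons r rs)) V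

/-! ### Restrictions on match rules

Consider a rule occurring in scope `a`, whose `all` prefix ends in scope `b`.  By the
de Bruijn level convention, inside its pattern the variables `i < a` are the ambient ones,
those with `a ≤ i < b` are the pattern variables of the rule, and those with `b ≤ i` are the
nominals bound inside the scope of the pattern variables, by `nab` or by a backslash of the
pattern. -/

/-- `HOVar a b p l`: `p` is a pattern variable applied to the distinct nominals listed in `l`,
all bound inside the scope of that pattern variable. -/
inductive HOVar {C : Type*} (a b : ℕ) : {n : ℕ} → Pat C n → List (Fin n) → Prop where
  | var {n : ℕ} (i : Fin n) : a ≤ i.val → i.val < b → HOVar a b (pvar (var i)) []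
  | arob {n : ℕ} (p : Pat C n) (l : List (Fin n)) (i : Fin n) :
      HOVar a b p l → b ≤ i.val → i ∉ l → HOVar a b (parob p (var i)) (i :: l)

/-- Well-formed patterns: pattern variables occur only as (heads of) higher-order pattern
variables, and `pnom` is applied to a nominal bound in the rule or to something that comes from
outside the rule, that is, a term over the ambient scope `a`. -/
inductive PatOK {C : Type*} (a b : ℕ) : {n : ℕ} → Pat C n → Prop where
  | hovar {n : ℕ} (p : Pat C n) (l : List (Fin n)) : HOVar a b p l → PatOK a b p
  | nomLocal {n : ℕ} (i : Fin n) : b ≤ i.val → PatOK a b (pnom (var i))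
  | nomAmbient {n : ℕ} (h : a ≤ n) (e : Tm C a) : PatOK a b (pnom (e.ren (Fin.castLE h)))
  | variant {n : ℕ} (c : C) (k : ℕ) (ps : Fin k → Pat C n) :
      (∀ i, PatOK a b (ps i)) → PatOK a b (pvariant c k ps)
  | back {n : ℕ} (p : Pat C (n + 1)) : PatOK a b p → PatOK a b (pback p)

/-- Number of occurrences of the variable `x`, as a pattern variable, in a pattern (phrases of
the other sorts count as `0`). -/
def pvarCount {C : Type*} (x : ℕ) : {n : ℕ} → {k : Kind} → Syn C n k → ℕ
  | _, _, pvar (var i) => if i.val = x then 1 else 0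
  | _, _, pvariant _ _ ps => ∑ i, pvarCount x (ps i)
  | _, _, pback p => pvarCount x p
  | _, _, parob p _ => pvarCount x p
  | _, _, _ => 0

/-- The nominal `z` has a rigid occurrence in the pattern: one that is not in the scope of
an `@`. -/
inductive Rigid {C : Type*} (z : ℕ) : {n : ℕ} → Pat C n → Prop where
  | nom {n : ℕ} (i : Fin n) : i.val = z → Rigid z (pnom (var i))
  | variant {n : ℕ} (c : C) (k : ℕ) (ps : Fin k → Pat C n) (i : Fin k) :
      Rigid z (ps i) → Rigid z (pvariant c k ps)
  | back {n : ℕ} (p : Pat C (n + 1)) : Rigid z p → Rigid z (pback p)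

/-- The matching restrictions on a rule occurring in scope `a`: the pattern is well formed,
each pattern variable occurs exactly once in it, and each `nab`-bound nominal has a rigid
occurrence in it. -/
inductive RuleOK {C : Type*} (a : ℕ) : {n : ℕ} → Syn C n .rule → Prop where
  | all {n : ℕ} (r : Syn C (n + 1) .rule) : RuleOK a r → RuleOK a (all r)
  | nab {n : ℕ} (m : ℕ) (p : Pat C (n + m)) (u : Tm C (n + m)) :
      PatOK a n p →
      (∀ x, a ≤ x → x < n → pvarCount x p = 1) →
      (∀ z, n ≤ z → z < n + m → Rigid z p) →
      RuleOK a (nab m (branch p u))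

/-- Every match rule in the phrase obeys the matching restrictions. -/
def Restricted {C : Type*} : {n : ℕ} → {k : Kind} → Syn C n k → Prop
  | _, _, nom _ => True
  | _, _, var _ => True
  | _, _, lam R => Restricted R
  | _, _, app M N => Restricted M ∧ Restricted N
  | _, _, letin M R => Restricted M ∧ Restricted R
  | _, _, fix R => Restricted R
  | _, _, new E => Restricted E
  | _, _, back E => Restricted E
  | _, _, arob M N => Restricted M ∧ Restricted N
  | _, _, variant _ _ ts => ∀ i, Restricted (ts i)
  | _, _, mtch T rs => Restricted T ∧ Restricted rs
  | _, _, pvar _ => True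
  | _, _, pnom _ => True
  | _, _, pvariant _ _ _ => True
  | _, _, pback _ => True
  | _, _, parob _ _ => True
  | _, _, branch _ u => Restricted u
  | _, _, nab _ b => Restricted b
  | _, _, all r => Restricted r
  | _, _, nil => True
  | n, _, cons r rs => RuleOK n r ∧ Restricted r ∧ Restricted rs

end MLTS

namespace MLTS

open Syn

variable {C : Type*}

/-! ### Substitution algebra -/

/-! Up to three kinds of choice, evaluation is syntax-directed: the fresh nominals used by `new`,
`back` and `pback`, the nominals taken for `nab`, and the terms taken for `all`. Determinacy means
that none of these choices affects the result.

Fresh nominals are harmless because matching and evaluation are equivariant under permutations of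
nominals (`Matches.perm`, `Eval.perm`), so a derivation for one fresh nominal can be moved to
another; `eval_abstraction_unique` turns this into uniqueness of the abstracted value.

For a match rule, the restrictions make the matched term determine the whole instantiation
(`RuleOK.clause_unique`). Rigid occurrences fix the `nab` nominals (`Rigid.matches_unique`). Pattern
variables occur as `r @ X₁ ⋯ Xₙ` with distinct nominals bound inside the scope of `r`, as in
Miller's higher-order patterns. The matching relation for `@` alone allows several abstractions,
since `R a = R' a` does not give `R = R'`; but those nominals cannot occur in the instance of `r`,
so every abstraction peeled off is fresh for its argument and hence unique (`HOVar.matches_arob`,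
`inst_nom_injective`).

The induction on evaluation also needs the restrictions to survive substitution, matching and
evaluation (`restricted_inst`, `Clause.restricted`, `Eval.restricted`), since evaluated terms are
instances of program fragments. -/

lemma liftRen_comp {n m l : ℕ} (k : ℕ) (ξ : Fin n → Fin m) (ζ : Fin m → Fin l) :
    (fun i => liftRen k ζ (liftRen k ξ i)) = liftRen k (fun i => ζ (ξ i)) := by
  funext i
  refine Fin.addCases (fun i => ?_) (fun i => ?_) i <;> simp [liftRen]

lemma ren_ren {n m l : ℕ} {s : Kind} (t : Syn C n s) (ξ : Fin n → Fin m) (ζ : Fin m → Fin l) :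
    (t.ren ξ).ren ζ = t.ren (fun i => ζ (ξ i)) := by
  induction t generalizing m l <;> simp only [ren, liftRen_comp, *]

lemma lift_liftRen {n m l : ℕ} (k : ℕ) (ξ : Fin n → Fin m) (σ : Fin m → Tm C l) :
    (fun i => lift k σ (liftRen k ξ i)) = lift k (fun i => σ (ξ i)) := by
  funext i
  refine Fin.addCases (fun i => ?_) (fun i => ?_) i <;> simp [liftRen, lift]

lemma sub_ren_left {n m l : ℕ} {s : Kind} (t : Syn C n s) (ξ : Fin n → Fin m)
    (σ : Fin m → Tm C l) (ν : ℕ → Tm C l) :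
    (t.ren ξ).sub σ ν = t.sub (fun i => σ (ξ i)) ν := by
  induction t generalizing m l <;> simp only [ren, sub, lift_liftRen, *]

lemma liftRen_castAdd {n m : ℕ} (k : ℕ) (ξ : Fin n → Fin m) (i : Fin n) :
    liftRen k ξ (Fin.castAdd k i) = Fin.castAdd k (ξ i) := by
  simp [liftRen]

lemma ren_weak {n m : ℕ} {s : Kind} (k : ℕ) (t : Syn C n s) (ξ : Fin n → Fin m) :
    (t.weak k).ren (liftRen k ξ) = (t.ren ξ).weak k := by
  simp [weak, ren_ren, liftRen_castAdd]

lemma ren_lift {n m l : ℕ} (k : ℕ) (σ : Fin n → Tm C m) (ξ : Fin m → Fin l) :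
    (fun i => (lift k σ i).ren (liftRen k ξ)) = lift k (fun i => (σ i).ren ξ) := by
  funext i
  refine Fin.addCases (fun i => ?_) (fun i => ?_) i
  · simp [lift, ren_weak]
  · simp [lift, ren, liftRen]

lemma ren_liftNom {m l : ℕ} (k : ℕ) (ν : ℕ → Tm C m) (ξ : Fin m → Fin l) :
    (fun a => (liftNom k ν a).ren (liftRen k ξ)) = liftNom k (fun a => (ν a).ren ξ) := by
  funext a
  simp [liftNom, ren_weak]

lemma ren_sub {n m l : ℕ} {s : Kind} (t : Syn C n s) (σ : Fin n → Tm C m) (ν : ℕ → Tm C m)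
    (ξ : Fin m → Fin l) :
    (t.sub σ ν).ren ξ = t.sub (fun i => (σ i).ren ξ) (fun a => (ν a).ren ξ) := by
  induction t generalizing m l <;> simp only [ren, sub, ren_lift, ren_liftNom, *]

lemma sub_weak {n m : ℕ} {s : Kind} (k : ℕ) (t : Syn C n s) (σ : Fin n → Tm C m)
    (ν : ℕ → Tm C m) :
    (t.weak k).sub (lift k σ) (liftNom k ν) = (t.sub σ ν).weak k := by
  simp only [weak, sub_ren_left, ren_sub]
  congr 1
  funext i
  simp [lift, weak]

lemma sub_lift {n m l : ℕ} (k : ℕ) (σ : Fin n → Tm C m) (τ : Fin m → Tm C l) (μ : ℕ → Tm C l) :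
    (fun i => (lift k σ i).sub (lift k τ) (liftNom k μ)) = lift k (fun i => (σ i).sub τ μ) := by
  funext i
  refine Fin.addCases (fun i => ?_) (fun i => ?_) i
  · simp [lift, ← sub_weak]
  · simp [lift, sub]

lemma sub_liftNom {m l : ℕ} (k : ℕ) (ν : ℕ → Tm C m) (τ : Fin m → Tm C l) (μ : ℕ → Tm C l) :
    (fun a => (liftNom k ν a).sub (lift k τ) (liftNom k μ)) =
      liftNom k (fun a => (ν a).sub τ μ) := by
  funext a
  simp only [liftNom, ← sub_weak]

/-- Instantiation, abstraction over nominals and permutation of nominals are all special cases of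
`sub`, so this law governs their interaction. The mixed laws for renamings come before it because
passing a binder weakens the substituted terms, and weakening is a renaming. -/
lemma sub_sub {n m l : ℕ} {s : Kind} (t : Syn C n s) (σ : Fin n → Tm C m) (ν : ℕ → Tm C m)
    (τ : Fin m → Tm C l) (μ : ℕ → Tm C l) :
    (t.sub σ ν).sub τ μ = t.sub (fun i => (σ i).sub τ μ) (fun a => (ν a).sub τ μ) := by
  induction t generalizing m l <;> simp only [sub, sub_lift, sub_liftNom, *]

lemma lift_var {n : ℕ} (k : ℕ) : lift k (var : Fin n → Tm C n) = var := by
  funext i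
  refine Fin.addCases (fun i => ?_) (fun i => ?_) i <;> simp [lift, weak, ren]

lemma liftNom_nom {n : ℕ} (k : ℕ) : liftNom k (nom : ℕ → Tm C n) = nom := by
  funext a
  simp [liftNom, weak, ren]

lemma sub_id {n : ℕ} {s : Kind} (t : Syn C n s) : t.sub var nom = t := by
  induction t <;> simp only [sub, lift_var, liftNom_nom, *]

lemma ren_eq_sub {n m : ℕ} {s : Kind} (t : Syn C n s) (ξ : Fin n → Fin m) :
    t.ren ξ = t.sub (fun i => var (ξ i)) nom := by
  conv_lhs => rw [← sub_id t, ren_sub]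
  rfl

/-! ### Occurrences of nominals -/

lemma occurs_ren {n m : ℕ} {s : Kind} (t : Syn C n s) (ξ : Fin n → Fin m) (a : ℕ) :
    (t.ren ξ).Occurs a ↔ t.Occurs a := by
  induction t generalizing m <;> simp only [ren, Occurs, *]

lemma sub_congr {n m : ℕ} {s : Kind} (t : Syn C n s) (σ : Fin n → Tm C m) {ν ν' : ℕ → Tm C m}
    (h : ∀ a, t.Occurs a → ν a = ν' a) : t.sub σ ν = t.sub σ ν' := by
  induction t generalizing m <;> simp only [sub, Occurs] at h ⊢
  case nom a => exact h a rfl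
  case lam R ih | fix R ih | new R ih | back R ih | pback R ih | all R ih | nab _ R ih =>
    exact congrArg _ (ih _ fun a ha => congrArg (weak _) (h a ha))
  case letin M R ih₁ ih₂ =>
    exact congrArg₂ _ (ih₁ _ fun a ha => h a (.inl ha))
      (ih₂ _ fun a ha => congrArg (weak _) (h a (.inr ha)))
  case app M N ih₁ ih₂ | arob M N ih₁ ih₂ | mtch M N ih₁ ih₂ | parob M N ih₁ ih₂ |
      branch M N ih₁ ih₂ | cons M N ih₁ ih₂ =>
    rw [ih₁ _ fun a ha => h a (.inl ha), ih₂ _ fun a ha => h a (.inr ha)]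
  case variant c k ts ih | pvariant c k ts ih =>
    congr 1
    exact funext fun i => ih i _ fun a ha => h a ⟨i, ha⟩
  case pvar e ih | pnom e ih => rw [ih _ h]

lemma exists_bound_occurs {n : ℕ} {s : Kind} (t : Syn C n s) :
    ∃ N, ∀ a, t.Occurs a → a < N := by
  induction t <;> simp only [Occurs]
  case nom a => exact ⟨a + 1, by simp⟩
  case var | nil => exact ⟨0, fun _ h => h.elim⟩
  case app ih₁ ih₂ | letin ih₁ ih₂ | arob ih₁ ih₂ | mtch ih₁ ih₂ | parob ih₁ ih₂ |
      branch ih₁ ih₂ | cons ih₁ ih₂ =>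
    obtain ⟨N₁, h₁⟩ := ih₁
    obtain ⟨N₂, h₂⟩ := ih₂
    exact ⟨max N₁ N₂, fun a ha => lt_max_iff.2 (ha.imp (h₁ a) (h₂ a))⟩
  case variant ih | pvariant ih =>
    choose N hN using ih
    exact ⟨Finset.univ.sup N, fun a ⟨i, hi⟩ =>
      (hN i a hi).trans_le (Finset.le_sup (Finset.mem_univ i))⟩
  all_goals assumption

lemma occurs_lift {n m : ℕ} {k : ℕ} {σ : Fin n → Tm C m} {i : Fin (n + k)} {a : ℕ}
    (h : (lift k σ i).Occurs a) : ∃ j, (σ j).Occurs a := by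
  induction i using Fin.addCases with
  | left i => exact ⟨i, by simpa [lift, weak, occurs_ren] using h⟩
  | right i => simp [lift, Occurs] at h

lemma occurs_liftNom {m k : ℕ} {ν : ℕ → Tm C m} {a b : ℕ} :
    (liftNom k ν b).Occurs a ↔ (ν b).Occurs a := occurs_ren _ _ _

lemma occurs_sub {n m : ℕ} {s : Kind} (t : Syn C n s) (σ : Fin n → Tm C m) (ν : ℕ → Tm C m)
    (a : ℕ) (h : (t.sub σ ν).Occurs a) :
    (∃ i, (σ i).Occurs a) ∨ ∃ b, t.Occurs b ∧ (ν b).Occurs a := by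
  induction t generalizing m <;> simp only [sub, Occurs] at h ⊢
  case nom b => exact .inr ⟨b, rfl, h⟩
  case var i => exact .inl ⟨i, h⟩
  case lam R ih | fix R ih | new R ih | back R ih | pback R ih | all R ih | nab _ R ih =>
    exact (ih _ _ h).imp (fun ⟨i, hi⟩ => occurs_lift hi)
      (fun ⟨b, hb, hab⟩ => ⟨b, hb, occurs_liftNom.1 hab⟩)
  case letin M R ih₁ ih₂ =>
    rcases h with h | h
    · exact (ih₁ _ _ h).imp_right (fun ⟨b, hb, hab⟩ => ⟨b, .inl hb, hab⟩)
    · exact (ih₂ _ _ h).imp (fun ⟨i, hi⟩ => occurs_lift hi)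
        (fun ⟨b, hb, hab⟩ => ⟨b, .inr hb, occurs_liftNom.1 hab⟩)
  case app M N ih₁ ih₂ | arob M N ih₁ ih₂ | mtch M N ih₁ ih₂ | parob M N ih₁ ih₂ |
      branch M N ih₁ ih₂ | cons M N ih₁ ih₂ =>
    rcases h with h | h
    · exact (ih₁ _ _ h).imp_right (fun ⟨b, hb, hab⟩ => ⟨b, .inl hb, hab⟩)
    · exact (ih₂ _ _ h).imp_right (fun ⟨b, hb, hab⟩ => ⟨b, .inr hb, hab⟩)
  case variant c k ts ih | pvariant c k ts ih =>
    obtain ⟨i, h⟩ := h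
    exact (ih i _ _ h).imp_right (fun ⟨b, hb, hab⟩ => ⟨b, ⟨i, hb⟩, hab⟩)
  case pvar e ih | pnom e ih => exact ih _ _ h

lemma occurs_sub_of_occurs {n m : ℕ} {s : Kind} (t : Syn C n s) (σ : Fin n → Tm C m)
    (ν : ℕ → Tm C m) {a b : ℕ} (hb : t.Occurs b) (h : (ν b).Occurs a) : (t.sub σ ν).Occurs a := by
  induction t generalizing m <;> simp only [sub, Occurs] at hb ⊢
  case nom => exact hb ▸ h
  case lam R ih | fix R ih | new R ih | back R ih | pback R ih | all R ih | nab _ R ih =>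
    exact ih _ _ hb (occurs_liftNom.2 h)
  case letin M R ih₁ ih₂ =>
    exact hb.imp (fun hb => ih₁ _ _ hb h) (fun hb => ih₂ _ _ hb (occurs_liftNom.2 h))
  case app M N ih₁ ih₂ | arob M N ih₁ ih₂ | mtch M N ih₁ ih₂ | parob M N ih₁ ih₂ |
      branch M N ih₁ ih₂ | cons M N ih₁ ih₂ =>
    exact hb.imp (fun hb => ih₁ _ _ hb h) (fun hb => ih₂ _ _ hb h)
  case variant c k ts ih | pvariant c k ts ih =>
    exact hb.imp fun i hb => ih i _ _ hb h
  case pvar e ih | pnom e ih => exact ih _ _ hb h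

/-! ### Abstraction over nominals and its inverse -/

/-- Application of an `m`-ary abstraction to the nominals `c`. -/
def instNoms {n m : ℕ} {s : Kind} (c : Fin m → ℕ) (b : Syn C (n + m) s) : Syn C n s :=
  b.sub (Fin.append var fun j => nom (c j)) nom

/-- Injectivity of `c` plays no role: whichever index is chosen for a nominal, applying the
abstraction to `c` returns that nominal. -/
lemma instNoms_abstr {n m : ℕ} {s : Kind} (c : Fin m → ℕ) (t : Syn C n s) :
    instNoms c (t.abstr c) = t := by
  rw [instNoms, abstr, sub_sub]
  conv_rhs => rw [← sub_id t]
  congr 1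
  · funext i
    simp [sub]
  · funext a
    split_ifs with h
    · simp [sub, h.choose_spec]
    · simp [sub]

/-- Here injectivity makes the chosen index the original one, and freshness keeps nominals already
present in `b` from being captured. -/
lemma abstr_instNoms {n m : ℕ} {s : Kind} {c : Fin m → ℕ} (hc : Function.Injective c)
    (b : Syn C (n + m) s) (h : ∀ j, ¬ b.Occurs (c j)) : (instNoms c b).abstr c = b := by
  rw [instNoms, abstr, sub_sub]
  conv_rhs => rw [← sub_id b]
  have hσ : (fun i => sub (fun i => var (Fin.castAdd m i))
      (fun a => if h : ∃ i, c i = a then var (Fin.natAdd n h.choose) else nom a)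
      (Fin.append var (fun j => (nom (c j) : Tm C n)) i)) = var := by
    funext i
    refine Fin.addCases (fun i => ?_) (fun i => ?_) i
    · simp [sub]
    · have hi : ∃ j, c j = c i := ⟨i, rfl⟩
      have : hi.choose = i := hc hi.choose_spec
      simp only [Fin.append_right, sub, dif_pos hi, this]
  rw [hσ]
  refine sub_congr _ _ fun a ha => ?_
  have : ¬ ∃ j, c j = a := fun ⟨j, hj⟩ => h j (hj ▸ ha)
  simp only [sub, dif_neg this]

lemma not_occurs_abstr {n m : ℕ} {s : Kind} (c : Fin m → ℕ) (t : Syn C n s) (j : Fin m) :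
    ¬ (t.abstr c).Occurs (c j) := by
  intro h
  rcases occurs_sub _ _ _ _ h with ⟨i, hi⟩ | ⟨b, -, hb⟩
  · exact hi
  · split_ifs at hb with h'
    · exact hb
    · exact h' ⟨j, hb⟩

/-- Abstracting and applying to distinct fresh nominals are mutually inverse. The applied form
exposes the freshness of `c` and transports easily along permutations. -/
lemma nomAbs_iff {n m : ℕ} {s : Kind} {b : Syn C (n + m) s} {t : Syn C n s} :
    NomAbs b t ↔ ∃ c : Fin m → ℕ, Function.Injective c ∧ (∀ j, ¬ b.Occurs (c j)) ∧
      t = instNoms c b := by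
  refine exists_congr fun c => and_congr_right fun hc => ⟨?_, ?_⟩
  · rintro rfl
    exact ⟨not_occurs_abstr c t, (instNoms_abstr c t).symm⟩
  · rintro ⟨h, rfl⟩
    exact (abstr_instNoms hc b h).symm

lemma abstr_inst_nom {n : ℕ} {s : Kind} {R : Syn C (n + 1) s} {a : ℕ} (h : ¬ R.Occurs a) :
    (R.inst (nom a)).abstr (fun _ : Fin 1 => a) = R :=
  abstr_instNoms (Function.injective_of_subsingleton _) R fun _ => h

/-- A fresh nominal marks exactly the places of the bound variable, so abstracting over it recovers
the abstraction. All uniqueness of abstractions rests on this. -/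
lemma inst_nom_injective {n : ℕ} {s : Kind} {R R' : Syn C (n + 1) s} {a : ℕ}
    (h : ¬ R.Occurs a) (h' : ¬ R'.Occurs a) (e : R.inst (nom a) = R'.inst (nom a)) : R = R' := by
  rw [← abstr_inst_nom h, e, abstr_inst_nom h']

lemma occurs_inst {n : ℕ} {s : Kind} {R : Syn C (n + 1) s} {x : Tm C n} {a : ℕ}
    (h : (R.inst x).Occurs a) : R.Occurs a ∨ x.Occurs a := by
  rcases occurs_sub _ _ _ _ h with ⟨i, hi⟩ | ⟨b, hb, hab⟩
  · right
    induction i using Fin.addCases with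
    | left i => simp [Occurs] at hi
    | right i => simpa using hi
  · left
    obtain rfl : a = b := hab
    exact hb

lemma occurs_inst_of_occurs {n : ℕ} {s : Kind} {R : Syn C (n + 1) s} {x : Tm C n} {a : ℕ}
    (h : R.Occurs a) : (R.inst x).Occurs a :=
  occurs_sub_of_occurs _ _ _ h rfl

/-! ### Permutations of nominals -/

/-- The action of a permutation of the nominals. -/
def perm {n : ℕ} {s : Kind} (π : Equiv.Perm ℕ) (t : Syn C n s) : Syn C n s :=
  t.sub var fun a => nom (π a)

lemma perm_perm {n : ℕ} {s : Kind} (π ρ : Equiv.Perm ℕ) (t : Syn C n s) :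
    perm π (perm ρ t) = perm (π * ρ) t := by
  simp [perm, sub_sub, sub]

lemma perm_one {n : ℕ} {s : Kind} (t : Syn C n s) : perm 1 t = t := sub_id t

lemma perm_inv_perm {n : ℕ} {s : Kind} (π : Equiv.Perm ℕ) (t : Syn C n s) :
    perm π⁻¹ (perm π t) = t := by
  rw [perm_perm, inv_mul_cancel, perm_one]

lemma occurs_perm {n : ℕ} {s : Kind} (π : Equiv.Perm ℕ) (t : Syn C n s) (a : ℕ) :
    (perm π t).Occurs (π a) ↔ t.Occurs a := by
  refine ⟨fun h => ?_, fun h => occurs_sub_of_occurs _ _ _ h rfl⟩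
  rcases occurs_sub _ _ _ _ h with ⟨i, hi⟩ | ⟨b, hb, hab⟩
  · exact hi.elim
  · rwa [π.injective hab]

lemma perm_eq_self {n : ℕ} {s : Kind} {π : Equiv.Perm ℕ} {t : Syn C n s}
    (h : ∀ a, t.Occurs a → π a = a) : perm π t = t := by
  conv_rhs => rw [← sub_id t]
  exact sub_congr _ _ fun a ha => by rw [h a ha]

lemma perm_swap_eq_self {n : ℕ} {s : Kind} {a b : ℕ} {t : Syn C n s}
    (ha : ¬ t.Occurs a) (hb : ¬ t.Occurs b) : perm (Equiv.swap a b) t = t :=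
  perm_eq_self fun _ hx => Equiv.swap_apply_of_ne_of_ne (fun e => ha (e ▸ hx)) (fun e => hb (e ▸ hx))

lemma liftNom_perm {n : ℕ} (k : ℕ) (π : Equiv.Perm ℕ) :
    liftNom k (fun a => (nom (π a) : Tm C n)) = fun a => nom (π a) := rfl

lemma perm_instNoms {n m : ℕ} {s : Kind} (π : Equiv.Perm ℕ) (c : Fin m → ℕ)
    (b : Syn C (n + m) s) : perm π (instNoms c b) = instNoms (fun j => π (c j)) (perm π b) := by
  simp only [perm, instNoms, sub_sub]
  congr 1
  funext i
  refine Fin.addCases (fun i => ?_) (fun i => ?_) i <;> simp [sub]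

lemma perm_inst {n : ℕ} {s : Kind} (π : Equiv.Perm ℕ) (R : Syn C (n + 1) s) (x : Tm C n) :
    perm π (R.inst x) = (perm π R).inst (perm π x) := by
  simp only [perm, inst, sub_sub]
  congr 1
  funext i
  refine Fin.addCases (fun i => ?_) (fun i => ?_) i <;> simp [sub]

lemma perm_inst_nom {n : ℕ} {s : Kind} (π : Equiv.Perm ℕ) (R : Syn C (n + 1) s) (a : ℕ) :
    perm π (R.inst (nom a)) = (perm π R).inst (nom (π a)) := perm_inst π R (nom a)

/-- The matching rules refer to nominals only through equality and freshness, both invariant under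
bijections. -/
lemma Matches.perm {T : Tm C 0} {P : Pat C 0} (h : Matches T P) (π : Equiv.Perm ℕ) :
    Matches (perm π T) (perm π P) := by
  induction h with
  | variant c k ts ps _ ih => exact .variant c k _ _ ih
  | nom a => exact .nom (π a)
  | var t => exact .var _
  | back t p a ht hp _ ih =>
    rw [perm_inst_nom, perm_inst_nom] at ih
    have := Matches.back _ _ (π a) (by rwa [occurs_perm]) (by rwa [occurs_perm]) ih
    simpa only [MLTS.perm, sub, lift_var, liftNom_perm] using this
  | arob s R p a hs _ ih =>
    refine .arob _ (MLTS.perm π R) _ (π a) (by rw [hs, perm_inst_nom]) ?_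
    simpa only [MLTS.perm, sub, lift_var, liftNom_perm] using ih

lemma NomAbs.perm {n m : ℕ} {s : Kind} {b : Syn C (n + m) s} {t : Syn C n s} (h : NomAbs b t)
    (π : Equiv.Perm ℕ) : NomAbs (perm π b) (perm π t) := by
  rw [nomAbs_iff] at h ⊢
  obtain ⟨c, hc, hb, rfl⟩ := h
  exact ⟨fun j => π (c j), π.injective.comp hc, fun j => by rw [occurs_perm]; exact hb j,
    perm_instNoms π c b⟩

lemma Clause.perm {T U : Tm C 0} {r : Syn C 0 .rule} (h : Clause T r U) (π : Equiv.Perm ℕ) :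
    Clause (perm π T) (perm π r) (perm π U) := by
  induction h with
  | all r x U _ ih =>
    rw [perm_inst] at ih
    simpa only [MLTS.perm, sub, lift_var, liftNom_perm] using Clause.all _ _ _ ih
  | nab m b P U hM hN =>
    have := Clause.nab m _ _ _ (hM.perm π) (hN.perm π)
    simpa only [MLTS.perm, sub, lift_var, liftNom_perm] using this

lemma Eval.perm {E V : Tm C 0} (h : Eval E V) (π : Equiv.Perm ℕ) :
    Eval (perm π E) (perm π V) := by
  induction h with
  | nom a => exact .nom (π a)
  | lam R => exact .lam _
  | variant c k ts vs _ ih => exact .variant c k _ _ ih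
  | new E V a hE hV _ ih =>
    rw [perm_inst_nom] at ih
    have := Eval.new _ _ (π a) (by rwa [occurs_perm]) (by rwa [occurs_perm]) ih
    simpa only [MLTS.perm, sub, lift_var, liftNom_perm] using this
  | app M N U V R _ _ _ ih₁ ih₂ ih₃ =>
    rw [perm_inst] at ih₃
    refine .app _ _ _ _ (MLTS.perm π R) ?_ ih₂ ih₃
    simpa only [MLTS.perm, sub, lift_var, liftNom_perm] using ih₁
  | letin M U V R _ _ ih₁ ih₂ =>
    rw [perm_inst] at ih₂
    simpa only [MLTS.perm, sub, lift_var, liftNom_perm] using Eval.letin _ _ _ _ ih₁ ih₂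
  | fix R V _ ih =>
    rw [perm_inst] at ih
    have h : MLTS.perm π (Syn.fix R) = Syn.fix (MLTS.perm π R) := by
      simp only [MLTS.perm, sub, lift_var, liftNom_perm]
    rw [h] at ih ⊢
    exact .fix _ _ ih
  | arob M X V R _ _ ih₁ ih₂ =>
    rw [perm_inst] at ih₂
    refine .arob _ _ _ (MLTS.perm π R) ?_ ih₂
    simpa only [MLTS.perm, sub, lift_var, liftNom_perm] using ih₁
  | back E V a hE hV _ ih =>
    rw [perm_inst_nom, perm_inst_nom] at ih
    have := Eval.back _ _ (π a) (by rwa [occurs_perm]) (by rwa [occurs_perm]) ih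
    simpa only [MLTS.perm, sub, lift_var, liftNom_perm] using this
  | matchHead T U V r rs hr _ ih => exact .matchHead _ _ _ _ _ (hr.perm π) ih
  | matchTail T V r rs hr _ ih =>
    refine .matchTail _ _ _ _ ?_ ih
    rintro ⟨u, hu⟩
    -- The negative premise is invariant because a match of the permuted term would be carried back
    -- by the inverse permutation.
    have := hu.perm π⁻¹
    change Clause (MLTS.perm π⁻¹ (MLTS.perm π T)) (MLTS.perm π⁻¹ (MLTS.perm π r)) _ at this
    rw [perm_inv_perm, perm_inv_perm] at this
    exact hr ⟨_, this⟩

/-! ### Stability of the matching restrictions under substitution -/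

/-- `σ` and `ν` arise by lifting the substitutions `σ₀ : Fin a → Tm C a'` and
`ν₀ : ℕ → Tm C a'` under `n - a` binders: the variables `≥ a` are shifted to the
variables `≥ a'`. -/
structure LiftOf {a a' n n' : ℕ} (σ₀ : Fin a → Tm C a') (ν₀ : ℕ → Tm C a')
    (σ : Fin n → Tm C n') (ν : ℕ → Tm C n') : Prop where
  le : a ≤ n
  le' : a' ≤ n'
  shift : n + a' = n' + a
  var_local : ∀ i : Fin n, a ≤ i.val → ∃ j : Fin n', j.val + a = i.val + a' ∧ σ i = var j
  var_ambient : ∀ i : Fin a, σ (Fin.castLE le i) = (σ₀ i).ren (Fin.castLE le')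
  nom_eq : ∀ x, ν x = (ν₀ x).ren (Fin.castLE le')

lemma ren_id {n : ℕ} {s : Kind} (t : Syn C n s) : t.ren (fun i => i) = t := by
  rw [ren_eq_sub]
  exact sub_id t

lemma LiftOf.refl {a a' : ℕ} (σ₀ : Fin a → Tm C a') (ν₀ : ℕ → Tm C a') :
    LiftOf σ₀ ν₀ σ₀ ν₀ where
  le := le_rfl
  le' := le_rfl
  shift := Nat.add_comm _ _
  var_local i hi := absurd i.isLt (by omega)
  var_ambient i := (ren_id _).symm
  nom_eq x := (ren_id _).symm

lemma LiftOf.lift {a a' n n' : ℕ} {σ₀ : Fin a → Tm C a'} {ν₀ : ℕ → Tm C a'}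
    {σ : Fin n → Tm C n'} {ν : ℕ → Tm C n'} (h : LiftOf σ₀ ν₀ σ ν) (k : ℕ) :
    LiftOf σ₀ ν₀ (lift k σ) (liftNom k ν) where
  le := h.le.trans (Nat.le_add_right _ _)
  le' := h.le'.trans (Nat.le_add_right _ _)
  shift := by have := h.shift; omega
  var_local i hi := by
    induction i using Fin.addCases with
    | left i =>
      obtain ⟨j, hj, e⟩ := h.var_local i hi
      exact ⟨Fin.castAdd k j, hj, by simp [Syn.lift, e, weak, ren]⟩
    | right i =>
      exact ⟨Fin.natAdd n' i, by have := h.shift; simp; omega, by simp [Syn.lift]⟩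
  var_ambient i := by
    have : Fin.castLE (h.le.trans (Nat.le_add_right n k)) i =
      Fin.castAdd k (Fin.castLE h.le i) := rfl
    rw [this, Syn.lift, Fin.append_left, h.var_ambient, weak, ren_ren]
    rfl
  nom_eq x := by
    rw [liftNom, h.nom_eq, weak, ren_ren]
    rfl

lemma LiftOf.sub_ambient {a a' n n' : ℕ} {σ₀ : Fin a → Tm C a'} {ν₀ : ℕ → Tm C a'}
    {σ : Fin n → Tm C n'} {ν : ℕ → Tm C n'} (h : LiftOf σ₀ ν₀ σ ν) {s : Kind} (e : Syn C a s) :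
    (e.ren (Fin.castLE h.le)).sub σ ν = (e.sub σ₀ ν₀).ren (Fin.castLE h.le') := by
  rw [sub_ren_left, ren_sub]
  congr 1
  · exact funext h.var_ambient
  · exact funext h.nom_eq

/-- Only ambient variables receive arbitrary terms; local ones are shifted from level `i` to `i + a'
- a`. This shift is injective, so the arguments remain distinct. The additive equations avoid
truncated subtraction. -/
lemma HOVar.sub {a a' b b' n n' : ℕ} {p : Pat C n} {l : List (Fin n)} (hp : HOVar a b p l)
    {σ₀ : Fin a → Tm C a'} {ν₀ : ℕ → Tm C a'} {σ : Fin n → Tm C n'} {ν : ℕ → Tm C n'}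
    (h : LiftOf σ₀ ν₀ σ ν) (hab : a ≤ b) (hb : b + a' = b' + a) :
    ∃ l', HOVar a' b' (p.sub σ ν) l' ∧ ∀ j ∈ l', ∃ i ∈ l, j.val + a = i.val + a' := by
  induction hp with
  | var i hi hib =>
    obtain ⟨j, hj, e⟩ := h.var_local i hi
    refine ⟨[], ?_, by simp⟩
    simp only [Syn.sub, e]
    exact .var j (by omega) (by omega)
  | arob p l i _ hi hil ih =>
    obtain ⟨l', hl', hll'⟩ := ih
    obtain ⟨j, hj, e⟩ := h.var_local i (by omega)
    refine ⟨j :: l', ?_, ?_⟩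
    · simp only [Syn.sub, e]
      refine .arob _ _ _ hl' (by omega) fun hjl => hil ?_
      obtain ⟨i', hi', e'⟩ := hll' j hjl
      rwa [Fin.ext (by omega : i.val = i'.val)]
    · intro x hx
      rcases List.mem_cons.1 hx with rfl | hx
      · exact ⟨i, by simp, hj⟩
      · obtain ⟨i', hi', e'⟩ := hll' x hx
        exact ⟨i', by simp [hi'], e'⟩

lemma PatOK.sub {a a' b b' n n' : ℕ} {p : Pat C n} (hp : PatOK a b p)
    {σ₀ : Fin a → Tm C a'} {ν₀ : ℕ → Tm C a'} {σ : Fin n → Tm C n'} {ν : ℕ → Tm C n'}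
    (h : LiftOf σ₀ ν₀ σ ν) (hab : a ≤ b) (hb : b + a' = b' + a) : PatOK a' b' (p.sub σ ν) := by
  induction hp generalizing n' with
  | hovar p l hp =>
    obtain ⟨l', hl', -⟩ := hp.sub h hab hb
    exact .hovar _ l' hl'
  | nomLocal i hi =>
    obtain ⟨j, hj, e⟩ := h.var_local i (by omega)
    simp only [Syn.sub, e]
    exact .nomLocal j (by omega)
  | nomAmbient hn e =>
    simp only [Syn.sub]
    rw [h.sub_ambient]
    exact .nomAmbient _ _
  | variant c k ps _ ih => exact .variant c k _ fun i => ih i h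
  | back p _ ih => exact .back _ (ih (h.lift 1))

lemma HOVar.pvarCount_sub {a a' b n n' x x' : ℕ} {p : Pat C n} {l : List (Fin n)}
    (hp : HOVar a b p l) {σ₀ : Fin a → Tm C a'} {ν₀ : ℕ → Tm C a'} {σ : Fin n → Tm C n'}
    {ν : ℕ → Tm C n'} (h : LiftOf σ₀ ν₀ σ ν) (hx : x + a' = x' + a) :
    pvarCount x' (p.sub σ ν) = pvarCount x p := by
  induction hp with
  | var i hi hib =>
    obtain ⟨j, hj, e⟩ := h.var_local i hi
    simp only [Syn.sub, e, pvarCount]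
    exact if_congr (by omega) rfl rfl
  | arob p l i _ hi hil ih =>
    simp only [Syn.sub, pvarCount]
    exact ih

/-- Well-formedness is essential: `pvar` applied to an ambient variable could become a new
occurrence of `x'` after substitution. -/
lemma PatOK.pvarCount_sub {a a' b n n' x x' : ℕ} {p : Pat C n} (hp : PatOK a b p)
    {σ₀ : Fin a → Tm C a'} {ν₀ : ℕ → Tm C a'} {σ : Fin n → Tm C n'} {ν : ℕ → Tm C n'}
    (h : LiftOf σ₀ ν₀ σ ν) (hx : x + a' = x' + a) :
    pvarCount x' (p.sub σ ν) = pvarCount x p := by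
  induction hp generalizing n' with
  | hovar p l hp => exact hp.pvarCount_sub h hx
  | nomLocal i hi => simp only [Syn.sub, pvarCount]
  | nomAmbient hn e => simp only [Syn.sub, pvarCount]
  | variant c k ps _ ih =>
    simp only [Syn.sub, pvarCount]
    exact Finset.sum_congr rfl fun i _ => ih i h
  | back p _ ih =>
    simp only [Syn.sub, pvarCount]
    exact ih (h.lift 1)

lemma Rigid.sub {a a' n n' z z' : ℕ} {p : Pat C n} (hp : Rigid z p)
    {σ₀ : Fin a → Tm C a'} {ν₀ : ℕ → Tm C a'} {σ : Fin n → Tm C n'} {ν : ℕ → Tm C n'}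
    (h : LiftOf σ₀ ν₀ σ ν) (haz : a ≤ z) (hz : z + a' = z' + a) : Rigid z' (p.sub σ ν) := by
  induction hp generalizing n' with
  | nom i hi =>
    obtain ⟨j, hj, e⟩ := h.var_local i (by omega)
    simp only [Syn.sub, e]
    exact .nom j (by omega)
  | variant c k ps i _ ih => exact .variant c k _ i (ih h)
  | back p _ ih => exact .back _ (ih (h.lift 1))

lemma RuleOK.sub {a a' n n' : ℕ} {r : Syn C n .rule} (hr : RuleOK a r)
    {σ₀ : Fin a → Tm C a'} {ν₀ : ℕ → Tm C a'} {σ : Fin n → Tm C n'} {ν : ℕ → Tm C n'}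
    (h : LiftOf σ₀ ν₀ σ ν) : RuleOK a' (r.sub σ ν) := by
  induction hr generalizing n' with
  | all r _ ih => exact .all _ (ih (h.lift 1))
  | @nab n m p u hp hx hz =>
    have hn := h.shift
    have hle := h.le
    have hle' := h.le'
    refine .nab m _ _ (hp.sub (h.lift m) h.le hn) (fun x h₁ h₂ => ?_) (fun z h₁ h₂ => ?_)
    -- The level `x + a - a'` is the preimage of `x` under the shift.
    · rw [hp.pvarCount_sub (x := x + a - a') (h.lift m) (by omega)]
      exact hx _ (by omega) (by omega)
    · exact (hz (z + a - a') (by omega) (by omega)).sub (h.lift m) (by omega) (by omega)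

/-- Substitution of terms in a class `P` of restricted terms that is closed under weakening
preserves the matching restrictions. -/
lemma restricted_sub_of {P : ∀ n, Tm C n → Prop} (hvar : ∀ n i, P n (var i))
    (hweak : ∀ n k t, P n t → P (n + k) (t.weak k)) (hP : ∀ n t, P n t → Restricted t)
    {n m : ℕ} {s : Kind} (t : Syn C n s) {σ : Fin n → Tm C m} {ν : ℕ → Tm C m}
    (ht : Restricted t) (hσ : ∀ i, P m (σ i)) (hν : ∀ a, P m (ν a)) :
    Restricted (t.sub σ ν) := by
  have hlift : ∀ {n m : ℕ} (k : ℕ) {σ : Fin n → Tm C m}, (∀ i, P m (σ i)) →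
      ∀ i, P (m + k) (lift k σ i) := by
    intro n m k σ hσ i
    induction i using Fin.addCases with
    | left i => simpa [lift] using hweak _ _ _ (hσ i)
    | right i => simpa [lift] using hvar _ _
  have hliftNom : ∀ {m : ℕ} (k : ℕ) {ν : ℕ → Tm C m}, (∀ i, P m (ν i)) →
      ∀ i, P (m + k) (liftNom k ν i) := fun k ν hν i => hweak _ _ _ (hν i)
  induction t generalizing m <;> simp only [sub, Restricted] at ht ⊢
  case nom a => exact hP _ _ (hν a)
  case var i => exact hP _ _ (hσ i)
  case lam R ih | fix R ih | new R ih | back R ih | all R ih | nab _ R ih =>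
    exact ih ht (hlift _ hσ) (hliftNom _ hν)
  case letin M R ih₁ ih₂ => exact ⟨ih₁ ht.1 hσ hν, ih₂ ht.2 (hlift _ hσ) (hliftNom _ hν)⟩
  case app M N ih₁ ih₂ | arob M N ih₁ ih₂ | mtch M N ih₁ ih₂ =>
    exact ⟨ih₁ ht.1 hσ hν, ih₂ ht.2 hσ hν⟩
  case variant c k ts ih => exact fun i => ih i (ht i) hσ hν
  case branch p u ih₁ ih₂ => exact ih₂ ht hσ hν
  case cons r rs ih₁ ih₂ =>
    -- The ambient scope of a rule is that of the list containing it, so the trivial lifting is the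
    -- right one.
    exact ⟨ht.1.sub (.refl σ ν), ih₁ ht.2.1 hσ hν, ih₂ ht.2.2 hσ hν⟩

/-- The class of variables and nominals is visibly closed under weakening. Treating it first gives
stability under renaming, which supplies the weakening hypothesis for the class of all restricted
terms. -/
lemma restricted_ren {n m : ℕ} {s : Kind} {t : Syn C n s} (ht : Restricted t)
    (ξ : Fin n → Fin m) : Restricted (t.ren ξ) := by
  rw [ren_eq_sub]
  refine restricted_sub_of (P := fun n t => (∃ i, t = var i) ∨ ∃ a, t = nom a)
    (fun n i => .inl ⟨i, rfl⟩) ?_ ?_ t ht (fun i => .inl ⟨_, rfl⟩) (fun a => .inr ⟨a, rfl⟩)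
  · rintro n k _ (⟨i, rfl⟩ | ⟨a, rfl⟩)
    · exact .inl ⟨_, rfl⟩
    · exact .inr ⟨_, rfl⟩
  · rintro n _ (⟨i, rfl⟩ | ⟨a, rfl⟩) <;> simp only [Restricted]

lemma restricted_sub {n m : ℕ} {s : Kind} {t : Syn C n s} {σ : Fin n → Tm C m}
    {ν : ℕ → Tm C m} (ht : Restricted t) (hσ : ∀ i, Restricted (σ i))
    (hν : ∀ a, Restricted (ν a)) : Restricted (t.sub σ ν) :=
  restricted_sub_of (P := fun _ t => Restricted t) (fun n i => by simp only [Restricted])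
    (fun n k t ht => restricted_ren ht _) (fun _ _ h => h) t ht hσ hν

lemma restricted_inst {n : ℕ} {s : Kind} {R : Syn C (n + 1) s} {x : Tm C n}
    (hR : Restricted R) (hx : Restricted x) : Restricted (R.inst x) := by
  refine restricted_sub hR (fun i => ?_) (fun a => by simp only [Restricted])
  refine Fin.addCases (fun i => ?_) (fun i => ?_) i
  · simp [Restricted]
  · simpa using hx

lemma restricted_of_inst_nom {n : ℕ} {s : Kind} {R : Syn C (n + 1) s} {a : ℕ}
    (ha : ¬ R.Occurs a) (h : Restricted (R.inst (nom a))) : Restricted R := by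
  rw [← abstr_inst_nom ha]
  refine restricted_sub h (fun i => by simp only [Restricted]) (fun b => ?_)
  dsimp only
  split_ifs <;> simp only [Restricted]

/-! ### Determinacy of matching -/

/-- A fresh nominal for finitely many phrases. -/
lemma exists_fresh {n : ℕ} {s : Kind} {ι : Type*} [Finite ι] (t : ι → Syn C n s) (F : Finset ℕ) :
    ∃ d, d ∉ F ∧ ∀ i, ¬ (t i).Occurs d := by
  cases nonempty_fintype ι
  choose N hN using fun i => exists_bound_occurs (t i)
  refine ⟨max (F.sup id + 1) (Finset.univ.sup N), fun h => ?_, fun i h => ?_⟩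
  · have := Finset.le_sup (f := id) h
    simp only [id] at this
    omega
  · have h₁ := hN i _ h
    have h₂ := Finset.le_sup (f := N) (Finset.mem_univ i)
    omega

/-- Swapping the nominal of the derivation with `d` fixes both bodies, since neither nominal occurs
in them. -/
lemma Matches.inst_of_fresh {t : Tm C 1} {p : Pat C 1} (h : Matches (Syn.back t) (pback p)) {d : ℕ}
    (ht : ¬ t.Occurs d) (hp : ¬ p.Occurs d) : Matches (t.inst (Syn.nom d)) (p.inst (Syn.nom d)) := by
  cases h with
  | back _ _ a ht' hp' h =>
    have := h.perm (Equiv.swap a d)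
    rwa [perm_inst_nom, perm_inst_nom, perm_swap_eq_self ht' ht, perm_swap_eq_self hp' hp,
      Equiv.swap_apply_left] at this

/-- Instantiating the last variable after a lifted substitution. -/
lemma sub_lift_inst {n : ℕ} {s : Kind} (p : Syn C (n + 1) s) (ρ : Fin n → Tm C 0) (x : Tm C 0) :
    (p.sub (lift 1 ρ) (liftNom 1 Syn.nom)).inst x = p.sub (Fin.append ρ fun _ => x) nom := by
  rw [inst, sub_sub]
  congr 1
  funext i
  refine Fin.addCases (fun i => ?_) (fun i => ?_) i
  · simp only [lift, Fin.append_left, weak, sub_ren_left]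
    exact sub_id _
  · simp only [lift, Fin.append_right, Syn.sub]

lemma instNoms_sub_lift {n m : ℕ} {s : Kind} (p : Syn C (n + m) s) (ρ : Fin n → Tm C 0)
    (c : Fin m → ℕ) :
    instNoms c (p.sub (lift m ρ) (liftNom m Syn.nom)) = p.sub (Fin.append ρ fun j => Syn.nom (c j)) nom := by
  rw [instNoms, sub_sub]
  congr 1
  funext i
  refine Fin.addCases (fun i => ?_) (fun i => ?_) i
  · simp only [lift, Fin.append_left, weak, sub_ren_left]
    exact sub_id _
  · simp only [lift, Fin.append_right, Syn.sub]

lemma not_occurs_sub_lift {n k : ℕ} {s : Kind} {p : Syn C (n + k) s} {ρ : Fin n → Tm C 0} {d : ℕ}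
    (hp : ¬ p.Occurs d) (hρ : ∀ i, ¬ (ρ i).Occurs d) :
    ¬ (p.sub (lift k ρ) (liftNom k Syn.nom)).Occurs d := by
  intro h
  rcases occurs_sub _ _ _ _ h with ⟨i, hi⟩ | ⟨b, hb, hab⟩
  · obtain ⟨j, hj⟩ := occurs_lift hi
    exact hρ j hj
  · obtain rfl : d = b := hab
    exact hp hb

/-- Two matchings of the same term with a `pback` pattern can use the same nominal. -/
lemma exists_fresh_matches {n : ℕ} {T : Tm C 0} {p : Pat C (n + 1)} {ρ ρ' : Fin n → Tm C 0}
    (h : Matches T ((pback p).sub ρ Syn.nom)) (h' : Matches T ((pback p).sub ρ' Syn.nom)) :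
    ∃ t d, T = Syn.back t ∧ ¬ t.Occurs d ∧ (∀ i, ¬ (ρ i).Occurs d) ∧ (∀ i, ¬ (ρ' i).Occurs d) ∧
      Matches (t.inst (Syn.nom d)) (p.sub (Fin.append ρ fun _ => Syn.nom d) Syn.nom) ∧
      Matches (t.inst (Syn.nom d)) (p.sub (Fin.append ρ' fun _ => Syn.nom d) Syn.nom) := by
  obtain ⟨Np, hNp⟩ := exists_bound_occurs p
  obtain ⟨t, rfl⟩ : ∃ t, T = Syn.back t := by
    simp only [Syn.sub] at h
    cases h
    exact ⟨_, rfl⟩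
  obtain ⟨Nt, hNt⟩ := exists_bound_occurs t
  obtain ⟨d, hd, hρ⟩ := exists_fresh (Sum.elim ρ ρ') (Finset.range (max Np Nt))
  simp only [Finset.mem_range, not_lt, sup_le_iff] at hd
  have hp : ¬ p.Occurs d := fun h => by have := hNp d h; omega
  have ht : ¬ t.Occurs d := fun h => by have := hNt d h; omega
  have hl : ∀ i, ¬ (ρ i).Occurs d := fun i => hρ (.inl i)
  have hr : ∀ i, ¬ (ρ' i).Occurs d := fun i => hρ (.inr i)
  refine ⟨t, d, rfl, ht, hl, hr, ?_, ?_⟩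
  · rw [← sub_lift_inst]
    exact Matches.inst_of_fresh h ht (not_occurs_sub_lift hp hl)
  · rw [← sub_lift_inst]
    exact Matches.inst_of_fresh h' ht (not_occurs_sub_lift hp hr)

/-- Matching determines the nominals that have a rigid occurrence. -/
lemma Rigid.matches_unique {n z : ℕ} {p : Pat C n} (hp : Rigid z p) {T : Tm C 0}
    {ρ ρ' : Fin n → Tm C 0} (h : Matches T (p.sub ρ Syn.nom)) (h' : Matches T (p.sub ρ' Syn.nom))
    (i : Fin n) (hi : i.val = z) : ρ i = ρ' i := by
  induction hp generalizing T with
  | nom j hj =>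
    -- An instance of `pnom` matches only the nominal it contains, so `T` itself is the common
    -- value.
    obtain rfl : i = j := Fin.ext (hi.trans hj.symm)
    simp only [Syn.sub] at h h'
    generalize ρ i = x at *
    generalize ρ' i = x' at *
    cases h
    cases h'
    rfl
  | variant c k ps j _ ih =>
    simp only [Syn.sub] at h h'
    cases h with
    | variant _ _ ts _ h =>
      cases h' with
      | variant _ _ _ _ h' => exact ih (h j) (h' j) i hi
  | back p _ ih =>
    obtain ⟨t, d, -, -, -, -, hm, hm'⟩ := exists_fresh_matches h h'
    simpa using ih hm hm' (Fin.castAdd 1 i) hi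

/-- The variables `≥ b` are instantiated by distinct nominals, which do not occur in the
instances of the variables `< b`. -/
structure FreshInst (b : ℕ) {n : ℕ} (ρ : Fin n → Tm C 0) : Prop where
  nom : ∀ i : Fin n, b ≤ i.val → ∃ c, ρ i = Syn.nom c
  inj : ∀ i j : Fin n, b ≤ i.val → b ≤ j.val → ρ i = ρ j → i = j
  fresh : ∀ (i j : Fin n) (c : ℕ), b ≤ i.val → j.val < b → ρ i = Syn.nom c → ¬ (ρ j).Occurs c

lemma FreshInst.append {b n m : ℕ} {ρ : Fin n → Tm C 0} (h : FreshInst b ρ)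
    {c : Fin m → ℕ} (hb : b ≤ n) (hc : Function.Injective c)
    (hρ : ∀ i j, ¬ (ρ i).Occurs (c j)) :
    FreshInst b (Fin.append ρ fun j => Syn.nom (c j)) where
  nom i hi := by
    induction i using Fin.addCases with
    | left i => simpa using h.nom i hi
    | right i => exact ⟨c i, by simp⟩
  inj i j hi hj e := by
    induction i using Fin.addCases with
    | left i =>
      induction j using Fin.addCases with
      | left j => rw [h.inj i j hi hj (by simpa using e)]
      | right j =>
        simp only [Fin.append_left, Fin.append_right] at e
        exact absurd (by rw [e]; rfl) (hρ i j)
    | right i =>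
      induction j using Fin.addCases with
      | left j =>
        simp only [Fin.append_left, Fin.append_right] at e
        exact absurd (by rw [← e]; rfl) (hρ j i)
      | right j =>
        simp only [Fin.append_right, Syn.nom.injEq] at e
        rw [hc e]
  fresh i j x hi hj e := by
    induction j using Fin.addCases with
    | left j =>
      induction i using Fin.addCases with
      | left i =>
        simp only [Fin.append_left] at e ⊢
        exact h.fresh i j x hi hj e
      | right i =>
        simp only [Fin.append_left, Fin.append_right, Syn.nom.injEq] at e ⊢
        exact e ▸ hρ j i
    | right j => simp at hj; omega

/-- Matching strips the arguments off `S` one at a time, so its nominals come from the instance of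
the head variable or from the arguments. -/
lemma HOVar.occurs {a b n : ℕ} {p : Pat C n} {l : List (Fin n)} (hp : HOVar a b p l)
    {ρ : Fin n → Tm C 0} (hρ : FreshInst b ρ) {S : Tm C 0} (h : Matches S (p.sub ρ Syn.nom)) {x : ℕ}
    (hx : S.Occurs x) :
    (∃ j : Fin n, j.val < b ∧ (ρ j).Occurs x) ∨ ∃ i ∈ l, ρ i = Syn.nom x := by
  induction hp generalizing S with
  | var i hi hib =>
    simp only [Syn.sub] at h
    cases h
    exact .inl ⟨i, hib, hx⟩
  | arob p l i _ hi hil ih =>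
    obtain ⟨c, hc⟩ := hρ.nom i hi
    simp only [Syn.sub, hc] at h
    cases h with
    | arob _ R _ _ hs h =>
      subst hs
      rcases occurs_inst hx with hx | hx
      · exact (ih h hx).imp_right fun ⟨j, hj, e⟩ => ⟨j, by simp [hj], e⟩
      · obtain rfl : x = c := hx
        exact .inr ⟨i, by simp, hc⟩

/-- Inversion of matching for a higher-order pattern variable applied to one more nominal. -/
lemma HOVar.matches_arob {a b n : ℕ} {p : Pat C n} {l : List (Fin n)} (hp : HOVar a b p l)
    (hlb : ∀ j ∈ l, b ≤ j.val) {i : Fin n} (hi : b ≤ i.val) (hil : i ∉ l) {ρ : Fin n → Tm C 0}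
    (hρ : FreshInst b ρ) {c : ℕ} (hc : ρ i = Syn.nom c) {S : Tm C 0}
    (h : Matches S ((parob p (Syn.var i)).sub ρ Syn.nom)) :
    ∃ R : Tm C 1, S = R.inst (Syn.nom c) ∧ ¬ R.Occurs c ∧ Matches (Syn.back R) (p.sub ρ Syn.nom) := by
  simp only [Syn.sub, hc] at h
  cases h with
  | arob _ R _ _ hs h =>
    refine ⟨R, hs, fun hR => ?_, h⟩
    -- If `c` survived in `R`, it would come from a pattern variable, against freshness, or from
    -- another argument, against distinctness.
    rcases hp.occurs hρ h (x := c) hR with ⟨j, hj, hj'⟩ | ⟨j, hj, e⟩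
    · exact hρ.fresh i j c hi hj hc hj'
    · exact hil (hρ.inj j i (hlb j hj) hi (e.trans hc.symm) ▸ hj)

lemma HOVar.le_of_mem {a b n : ℕ} {p : Pat C n} {l : List (Fin n)} (hp : HOVar a b p l) :
    ∀ j ∈ l, b ≤ j.val := by
  induction hp with
  | var i hi hib => simp
  | arob p l i _ hi hil ih =>
    intro j hj
    rcases List.mem_cons.1 hj with rfl | hj
    · exact hi
    · exact ih j hj

/-- Both matchings strip the same nominal, fresh for both abstractions, so these agree; repeating
this reaches the bare pattern variable. -/
lemma HOVar.matches_unique {a b n : ℕ} {p : Pat C n} {l : List (Fin n)} (hp : HOVar a b p l)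
    {ρ ρ' : Fin n → Tm C 0} (hρ : FreshInst b ρ) (hρ' : FreshInst b ρ')
    (hb : ∀ i : Fin n, b ≤ i.val → ρ i = ρ' i) {T : Tm C 0} (h : Matches T (p.sub ρ Syn.nom))
    (h' : Matches T (p.sub ρ' Syn.nom)) (x : Fin n) (hx : pvarCount x.val p ≠ 0) : ρ x = ρ' x := by
  induction hp generalizing T with
  | var i hi hib =>
    simp only [pvarCount, ne_eq, ite_eq_right_iff, one_ne_zero, imp_false, not_not] at hx
    obtain rfl := Fin.ext hx
    simp only [Syn.sub] at h h'
    generalize ρ i = y at h ⊢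
    generalize ρ' i = y' at h' ⊢
    cases h
    cases h'
    rfl
  | arob p l i hp hi hil ih =>
    obtain ⟨c, hc⟩ := hρ.nom i hi
    obtain ⟨R, rfl, hR, hM⟩ := hp.matches_arob hp.le_of_mem hi hil hρ hc h
    obtain ⟨R', e, hR', hM'⟩ := hp.matches_arob hp.le_of_mem hi hil hρ' ((hb i hi).symm.trans hc) h'
    obtain rfl := inst_nom_injective hR hR' e
    exact ih hM hM' (by simpa only [pvarCount] using hx)

lemma HOVar.matches_restricted {a b n : ℕ} {p : Pat C n} {l : List (Fin n)} (hp : HOVar a b p l)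
    {ρ : Fin n → Tm C 0} (hρ : FreshInst b ρ) {T : Tm C 0} (hT : Restricted T)
    (h : Matches T (p.sub ρ Syn.nom)) (x : Fin n) (hx : pvarCount x.val p ≠ 0) :
    Restricted (ρ x) := by
  induction hp generalizing T with
  | var i hi hib =>
    simp only [pvarCount, ne_eq, ite_eq_right_iff, one_ne_zero, imp_false, not_not] at hx
    obtain rfl := Fin.ext hx
    simp only [Syn.sub] at h
    cases h
    exact hT
  | arob p l i hp hi hil ih =>
    obtain ⟨c, hc⟩ := hρ.nom i hi
    obtain ⟨R, rfl, hR, hM⟩ := hp.matches_arob hp.le_of_mem hi hil hρ hc h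
    exact ih (by simpa only [Restricted] using restricted_of_inst_nom hR hT) hM
      (by simpa only [pvarCount] using hx)

lemma append_nom_eq {n b : ℕ} {ρ ρ' : Fin n → Tm C 0} (h : ∀ i : Fin n, b ≤ i.val → ρ i = ρ' i)
    {m : ℕ} (c : Fin m → Tm C 0) (i : Fin (n + m)) (hi : b ≤ i.val) :
    Fin.append ρ c i = Fin.append ρ' c i := by
  induction i using Fin.addCases with
  | left i => simpa using h i hi
  | right i => simp

/-- Matching determines the instances of the pattern variables. -/
lemma PatOK.matches_unique {a b n : ℕ} {p : Pat C n} (hp : PatOK a b p) (hbn : b ≤ n)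
    {ρ ρ' : Fin n → Tm C 0} (hρ : FreshInst b ρ) (hρ' : FreshInst b ρ')
    (hb : ∀ i : Fin n, b ≤ i.val → ρ i = ρ' i) {T : Tm C 0} (h : Matches T (p.sub ρ Syn.nom))
    (h' : Matches T (p.sub ρ' Syn.nom)) (x : Fin n) (hx : pvarCount x.val p ≠ 0) : ρ x = ρ' x := by
  induction hp generalizing T with
  | hovar p l hp => exact hp.matches_unique hρ hρ' hb h h' x hx
  | nomLocal i hi => exact absurd (by simp only [pvarCount]) hx
  | nomAmbient hn e => exact absurd (by simp only [pvarCount]) hx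
  | variant c k ps _ ih =>
    simp only [Syn.sub] at h h'
    simp only [pvarCount] at hx
    obtain ⟨j, -, hj⟩ := Finset.exists_ne_zero_of_sum_ne_zero hx
    cases h with
    | variant _ _ ts _ h =>
      cases h' with
      | variant _ _ _ _ h' => exact ih j hbn hρ hρ' hb (h j) (h' j) x hj
  | @back n p _ ih =>
    obtain ⟨t, d, -, -, hd, hd', hm, hm'⟩ := exists_fresh_matches h h'
    have hinj : Function.Injective fun _ : Fin 1 => d := Function.injective_of_subsingleton _
    -- The nominal `d` for the backslash becomes one more fresh local nominal, on the same footing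
    -- as those bound by `nab`.
    simpa using ih (by omega) (hρ.append hbn hinj fun i _ => hd i)
      (hρ'.append hbn hinj fun i _ => hd' i) (append_nom_eq hb _) hm hm' (Fin.castAdd 1 x)
      (by simpa only [pvarCount, Fin.val_castAdd] using hx)

/-- The instances of the pattern variables obey the matching restrictions if the matched term
does. -/
lemma PatOK.matches_restricted {a b n : ℕ} {p : Pat C n} (hp : PatOK a b p) (hbn : b ≤ n)
    {ρ : Fin n → Tm C 0} (hρ : FreshInst b ρ) {T : Tm C 0} (hT : Restricted T)
    (h : Matches T (p.sub ρ Syn.nom)) (x : Fin n) (hx : pvarCount x.val p ≠ 0) :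
    Restricted (ρ x) := by
  induction hp generalizing T with
  | hovar p l hp => exact hp.matches_restricted hρ hT h x hx
  | nomLocal i hi => exact absurd (by simp only [pvarCount]) hx
  | nomAmbient hn e => exact absurd (by simp only [pvarCount]) hx
  | variant c k ps _ ih =>
    simp only [Syn.sub] at h
    simp only [pvarCount] at hx
    obtain ⟨j, -, hj⟩ := Finset.exists_ne_zero_of_sum_ne_zero hx
    cases h with
    | variant _ _ ts _ h =>
      simp only [Restricted] at hT
      exact ih j hbn hρ (hT j) (h j) x hj
  | @back n p _ ih =>
    obtain ⟨t, d, rfl, -, hd, -, hm, -⟩ := exists_fresh_matches h h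
    have hinj : Function.Injective fun _ : Fin 1 => d := Function.injective_of_subsingleton _
    simp only [Restricted] at hT
    simpa using ih (by omega) (hρ.append hbn hinj fun i _ => hd i)
      (restricted_inst hT (by simp only [Restricted])) hm (Fin.castAdd 1 x)
      (by simpa only [pvarCount, Fin.val_castAdd] using hx)

/-- Nominals of the instance of a pattern variable occur in the instance of the pattern. -/
lemma PatOK.occurs_sub {a b n m : ℕ} {p : Pat C n} (hp : PatOK a b p) {σ : Fin n → Tm C m}
    {ν : ℕ → Tm C m} (x : Fin n) (hx : pvarCount x.val p ≠ 0) {c : ℕ} (hc : (σ x).Occurs c) :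
    (p.sub σ ν).Occurs c := by
  induction hp generalizing m with
  | hovar p l hp =>
    induction hp with
    | var i hi hib =>
      simp only [pvarCount, ne_eq, ite_eq_right_iff, one_ne_zero, imp_false, not_not] at hx
      obtain rfl := Fin.ext hx
      simpa only [Syn.sub, Occurs] using hc
    | arob p l i _ hi hil ih =>
      simp only [Syn.sub, Occurs]
      exact .inl (ih (by simpa only [pvarCount] using hx))
  | nomLocal i hi => exact absurd (by simp only [pvarCount]) hx
  | nomAmbient hn e => exact absurd (by simp only [pvarCount]) hx
  | variant c k ps _ ih =>
    simp only [pvarCount] at hx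
    obtain ⟨j, -, hj⟩ := Finset.exists_ne_zero_of_sum_ne_zero hx
    simp only [Syn.sub, Occurs]
    exact ⟨j, ih j x hj hc⟩
  | back p _ ih =>
    simp only [Syn.sub, Occurs]
    exact ih (Fin.castAdd 1 x) (by simpa only [pvarCount, Fin.val_castAdd] using hx)
      (by simpa [lift, weak, occurs_ren] using hc)

/-- Vacuous: no variable has level at least `n`. The `nab` nominals are appended to this base case.
-/
lemma freshInst_self {n : ℕ} (ρ : Fin n → Tm C 0) : FreshInst n ρ where
  nom i hi := absurd i.isLt (by omega)
  inj i _ hi := absurd i.isLt (by omega)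
  fresh i _ _ hi := absurd i.isLt (by omega)

/-- Inversion of `Clause` at the `nab` prefix of an instance of a rule. -/
lemma Clause.nab_inv {n m : ℕ} {p : Pat C (n + m)} {u : Tm C (n + m)} (hp : PatOK 0 n p)
    (hx : ∀ x, 0 ≤ x → x < n → pvarCount x p = 1) {T U : Tm C 0} {ρ : Fin n → Tm C 0}
    (h : Clause T ((Syn.nab m (branch p u)).sub ρ Syn.nom) U) :
    ∃ c : Fin m → ℕ, FreshInst n (Fin.append ρ fun j => Syn.nom (c j)) ∧
      Matches T (p.sub (Fin.append ρ fun j => Syn.nom (c j)) Syn.nom) ∧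
      U = u.sub (Fin.append ρ fun j => Syn.nom (c j)) Syn.nom := by
  simp only [Syn.sub] at h
  cases h with
  | nab _ _ P _ hM hN =>
    obtain ⟨c, hc, hbc, e⟩ := nomAbs_iff.1 hN
    have e' : branch P U = branch (instNoms c (p.sub (lift m ρ) (liftNom m Syn.nom)))
      (instNoms c (u.sub (lift m ρ) (liftNom m Syn.nom))) := e
    rw [instNoms_sub_lift, instNoms_sub_lift] at e'
    injection e' with _ e₁ e₂
    subst e₁ e₂
    -- Every pattern variable occurs in the pattern, so a nominal of its instance occurs in the body
    -- from which `c j` is excluded.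
    refine ⟨c, (freshInst_self ρ).append le_rfl hc fun i j hij => hbc j ?_, hM, rfl⟩
    refine .inl (hp.occurs_sub (Fin.castAdd m i) ?_ ?_)
    · rw [Fin.val_castAdd, hx i.val (Nat.zero_le _) i.isLt]
      exact one_ne_zero
    · simpa [lift, weak, occurs_ren] using hij

/-- The two derivations choose their instances of the `all` prefix independently, hence two
substitutions. With ambient scope `0`, every variable of `u` is a pattern variable or a `nab`
nominal; the latter are settled first, since uniqueness for the former presupposes agreement on
them. -/
lemma RuleOK.clause_unique {n : ℕ} {r : Syn C n .rule} (hr : RuleOK 0 r) {T U U' : Tm C 0}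
    {ρ ρ' : Fin n → Tm C 0} (h : Clause T (r.sub ρ Syn.nom) U) (h' : Clause T (r.sub ρ' Syn.nom) U') :
    U = U' := by
  induction hr with
  | all r _ ih =>
    simp only [Syn.sub] at h h'
    cases h with
    | all _ x _ h =>
      cases h' with
      | all _ x' _ h' =>
        rw [sub_lift_inst] at h h'
        exact ih h h'
  | @nab n m p u hp hx hz =>
    obtain ⟨c, hF, hM, rfl⟩ := Clause.nab_inv hp hx h
    obtain ⟨c', hF', hM', rfl⟩ := Clause.nab_inv hp hx h'
    have hnab : ∀ i : Fin (n + m), n ≤ i.val → Fin.append ρ (fun j => Syn.nom (c j)) i =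
        Fin.append ρ' (fun j => Syn.nom (c' j)) i :=
      fun i hi => (hz i.val hi i.isLt).matches_unique hM hM' i rfl
    congr 1
    funext i
    rcases le_or_gt n i.val with hi | hi
    · exact hnab i hi
    · refine hp.matches_unique (Nat.le_add_right _ _) hF hF' hnab hM hM' i ?_
      rw [hx i.val (Nat.zero_le _) hi]
      exact one_ne_zero

/-- Instances of pattern variables are parts of `T`, possibly abstracted over fresh nominals, and so
inherit its restrictions. -/
lemma RuleOK.clause_restricted {n : ℕ} {r : Syn C n .rule} (hr : RuleOK 0 r)
    (hres : Restricted r) {T U : Tm C 0} (hT : Restricted T) {ρ : Fin n → Tm C 0}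
    (h : Clause T (r.sub ρ Syn.nom) U) : Restricted U := by
  induction hr with
  | all r _ ih =>
    simp only [Syn.sub] at h
    simp only [Restricted] at hres
    cases h with
    | all _ x _ h =>
      rw [sub_lift_inst] at h
      exact ih hres h
  | @nab n m p u hp hx hz =>
    obtain ⟨c, hF, hM, rfl⟩ := Clause.nab_inv hp hx h
    simp only [Restricted] at hres
    refine restricted_sub hres (fun i => ?_) (fun a => by simp only [Restricted])
    rcases le_or_gt n i.val with hi | hi
    · obtain ⟨x, e⟩ := hF.nom i hi
      simp only [e, Restricted]
    · refine hp.matches_restricted (Nat.le_add_right _ _) hF hT hM i ?_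
      rw [hx i.val (Nat.zero_le _) hi]
      exact one_ne_zero

lemma Clause.unique {T U U' : Tm C 0} {r : Syn C 0 .rule} (hr : RuleOK 0 r)
    (h : Clause T r U) (h' : Clause T r U') : U = U' := by
  rw [← sub_id r] at h h'
  exact hr.clause_unique h h'

lemma Clause.restricted {T U : Tm C 0} {r : Syn C 0 .rule} (hr : RuleOK 0 r)
    (hres : Restricted r) (hT : Restricted T) (h : Clause T r U) : Restricted U := by
  rw [← sub_id r] at h
  exact hr.clause_restricted hres hT h

/-! ### Determinacy of evaluation -/

/-- Evaluation preserves the matching restrictions. -/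
lemma Eval.restricted {E V : Tm C 0} (h : Eval E V) (hE : Restricted E) : Restricted V := by
  induction h with
  | nom a => exact hE
  | lam R => exact hE
  | variant c k ts vs _ ih =>
    simp only [Restricted] at hE ⊢
    exact fun i => ih i (hE i)
  | new E V a _ _ _ ih =>
    simp only [Restricted] at hE
    exact ih (restricted_inst hE (by simp only [Restricted]))
  | app M N U V R _ _ _ ih₁ ih₂ ih₃ =>
    simp only [Restricted] at hE ih₁
    exact ih₃ (restricted_inst (ih₁ hE.1) (ih₂ hE.2))
  | letin M U V R _ _ ih₁ ih₂ =>
    simp only [Restricted] at hE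
    exact ih₂ (restricted_inst hE.2 (ih₁ hE.1))
  | fix R V _ ih =>
    refine ih (restricted_inst ?_ hE)
    simpa only [Restricted] using hE
  | arob M X V R _ _ ih₁ ih₂ =>
    simp only [Restricted] at hE ih₁
    exact ih₂ (restricted_inst (ih₁ hE.1) hE.2)
  | back E V a _ hV _ ih =>
    simp only [Restricted] at hE ⊢
    exact restricted_of_inst_nom hV (ih (restricted_inst hE (by simp only [Restricted])))
  | matchHead T U V r rs hr _ ih =>
    simp only [Restricted] at hE
    exact ih (hr.restricted hE.2.1 hE.2.2.1 hE.1)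
  | matchTail T V r rs _ _ ih =>
    simp only [Restricted] at hE ih
    exact ih ⟨hE.1, hE.2.2.2⟩

/-- If `E x` evaluates to `V x` for one fresh nominal, it does so for all. -/
lemma Eval.change_nom {E V : Tm C 1} {a d : ℕ} (h : Eval (E.inst (Syn.nom a)) (V.inst (Syn.nom a)))
    (hEa : ¬ E.Occurs a) (hVa : ¬ V.Occurs a) (hEd : ¬ E.Occurs d) (hVd : ¬ V.Occurs d) :
    Eval (E.inst (Syn.nom d)) (V.inst (Syn.nom d)) := by
  have := h.perm (Equiv.swap a d)
  rwa [perm_inst_nom, perm_inst_nom, perm_swap_eq_self hEa hEd, perm_swap_eq_self hVa hVd,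
    Equiv.swap_apply_left] at this

lemma weak_inst {s : Kind} (t : Syn C 0 s) (x : Tm C 0) : (t.weak 1).inst x = t := by
  rw [inst, weak, sub_ren_left]
  conv_rhs => rw [← sub_id t]
  congr 1
  funext i
  simp

/-- The values of an abstraction at two fresh nominals have the same abstraction, as soon as the
value at one of them is unique. -/
lemma eval_abstraction_unique {E V V' : Tm C 1} {a b : ℕ}
    (hEa : ¬ E.Occurs a) (hVa : ¬ V.Occurs a) (hEb : ¬ E.Occurs b) (hVb : ¬ V'.Occurs b)
    (huniq : ∀ U, Eval (E.inst (Syn.nom a)) U → V.inst (Syn.nom a) = U)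
    (h' : Eval (E.inst (nom b)) (V'.inst (nom b))) : V = V' := by
  obtain ⟨d, hda, hd⟩ := exists_fresh ![E, V, V'] {a}
  have hEd : ¬ E.Occurs d := hd 0
  have hVd : ¬ V.Occurs d := hd 1
  have hVd' : ¬ V'.Occurs d := hd 2
  have hda : d ≠ a := by simpa using hda
  -- Since `V'` might contain `a`, the passage from `b` to `a` goes through `d`; the second swap may
  -- then alter `V'`.
  have h₁ := (h'.change_nom hEb hVb hEd hVd').perm (Equiv.swap d a)
  rw [perm_inst_nom, perm_inst_nom, perm_swap_eq_self hEd hEa, Equiv.swap_apply_left] at h₁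
  have e := huniq _ h₁
  -- If `a` occurred in `V'`, the swap would put `d` into the value at `a`, but `d` is fresh for `V`
  -- and differs from `a`.
  have hVa' : ¬ V'.Occurs a := by
    intro hc
    have : (perm (Equiv.swap d a) V').Occurs d := by
      have := (occurs_perm (Equiv.swap d a) V' a).2 hc
      rwa [Equiv.swap_apply_right] at this
    have := occurs_inst_of_occurs (x := Syn.nom a) this
    rw [← e] at this
    rcases occurs_inst this with h | h
    · exact hVd h
    · exact hda h
  rw [perm_swap_eq_self hVd' hVa'] at e
  exact inst_nom_injective hVa hVa' e

lemma Eval.unique {E V U : Tm C 0} (hE : Restricted E) (hV : Eval E V) (hU : Eval E U) :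
    V = U := by
  induction hV generalizing U with
  | nom a =>
    cases hU
    rfl
  | lam R =>
    cases hU
    rfl
  | variant c k ts vs _ ih =>
    simp only [Restricted] at hE
    cases hU with
    | variant _ _ _ us hu =>
      congr 1
      exact funext fun i => ih i (hE i) (hu i)
  | new E V a hEa hVa _ ih =>
    simp only [Restricted] at hE
    cases hU with
    | new _ _ b hEb hUb hU =>
      have hoc : ∀ (t : Tm C 0) x, ¬ t.Occurs x → ¬ (t.weak 1).Occurs x :=
        fun t x ht => by rwa [weak, occurs_ren]
      -- A value not containing the nominal is a constant abstraction, which reduces `new` to the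
      -- argument for `back`.
      have e : V.weak 1 = U.weak 1 := by
        refine eval_abstraction_unique hEa (hoc _ _ hVa) hEb (hoc _ _ hUb) ?_ ?_
        · rw [weak_inst]
          exact fun W hW => ih (restricted_inst hE (by simp only [Restricted])) hW
        · rwa [weak_inst]
      rw [← weak_inst V (Syn.nom a), e, weak_inst]
  | app M N W V R hM hN _ ih₁ ih₂ ih₃ =>
    simp only [Restricted] at hE
    cases hU with
    | app _ _ W' _ R' hM' hN' hU =>
      cases ih₁ hE.1 hM'
      cases ih₂ hE.2 hN'
      have hR := hM.restricted hE.1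
      simp only [Restricted] at hR
      exact ih₃ (restricted_inst hR (hN.restricted hE.2)) hU
  | letin M W V R hM _ ih₁ ih₂ =>
    simp only [Restricted] at hE
    cases hU with
    | letin _ W' _ _ hM' hU =>
      cases ih₁ hE.1 hM'
      exact ih₂ (restricted_inst hE.2 (hM.restricted hE.1)) hU
  | fix R V _ ih =>
    cases hU with
    | fix _ _ hU =>
      refine ih (restricted_inst ?_ hE) hU
      simpa only [Restricted] using hE
  | arob M X V R hM _ ih₁ ih₂ =>
    simp only [Restricted] at hE
    cases hU with
    | arob _ _ _ R' hM' hU =>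
      cases ih₁ hE.1 hM'
      have hR := hM.restricted hE.1
      simp only [Restricted] at hR
      exact ih₂ (restricted_inst hR hE.2) hU
  | back E V a hEa hVa _ ih =>
    simp only [Restricted] at hE
    cases hU with
    | back _ V' b hEb hVb hU =>
      rw [eval_abstraction_unique hEa hVa hEb hVb
        (fun W hW => ih (restricted_inst hE (by simp only [Restricted])) hW) hU]
  | matchHead T W V r rs hr _ ih =>
    simp only [Restricted] at hE
    cases hU with
    | matchHead _ W' _ _ _ hr' hU =>
      cases hr.unique hE.2.1 hr'
      exact ih (hr.restricted hE.2.1 hE.2.2.1 hE.1) hU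
    -- The negative premise makes the two match rules mutually exclusive.
    | matchTail _ _ _ _ hr' hU => exact absurd ⟨_, hr⟩ hr'
  | matchTail T V r rs hr _ ih =>
    simp only [Restricted] at hE ih
    cases hU with
    | matchHead _ W' _ _ _ hr' hU => exact absurd ⟨_, hr'⟩ hr
    | matchTail _ _ _ _ _ hU => exact ih ⟨hE.1, hE.2.2.2⟩ hU

end MLTS

theorem mainTheorem3 {C : Type*} (E V U : MLTS.Tm C 0) (hE : MLTS.Restricted E)
    (hV : MLTS.Eval E V) (hU : MLTS.Eval E U) : V = U :=
  hV.unique hE hU
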